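/- Let $L^2(0,1)=L^2((0,1);\mathbb R)$ and let $E=C([0,1];\mathbb R)$ be equipped with the norm $\|x\|_E=\max_{\xi\in[0,1]}|x(\xi)|$. For $k\in\mathbb N=\{1,2,\dots\}$ set $\lambda_k=k^2\pi^2$ and $e_k(\xi)=\sqrt2\sin(k\pi\xi)$, and let $S(t)x=\sum_{k\in\mathbb N}e^{-\lambda_k t}\langle x,e_k\rangle e_k$ be the semigroup on $L^2(0,1)$ generated by the Dirichlet Laplacian. Let $H\in(1/4,1/2)\cup(1/2,1)$ and let $(\beta_k^H)_{k\in\mathbb N}$ be independent real-valued fractional Brownian motions with Hurst index $H$ on a probability space $(\Omega,\mathcal F,\mathbb P)$, i.e. centered Gaussian processes $(\beta_k^H(t))_{t\ge0}$ with almost surely continuous paths and covariance $\mathbb E[\beta_k^H(t)\beta_k^H(s)]=\frac12\bigl(t^{2H}+s^{2H}-|t-s|^{2H}\bigr)$. For $\phi$ of class $C^1$ on $[0,T]$ put $$\int_0^T\phi(s)\,\mathrm d\beta_k^H(s)=\phi(T)\beta_k^H(T)-\int_0^T\phi'(s)\beta_k^H(s)\,\mathrm ds ,$$ and for $t\ge0$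 let $$Z^H(t)=\int_0^tS(t-s)\,\mathrm dB^H(s):=\sum_{k,\ell\in\mathbb N}\Bigl(\int_0^t\langle S(t-s)e_\ell,e_k\rangle\,\mathrm d\beta_\ell^H(s)\Bigr)e_k .$$ Then, for every $t\ge0$, almost surely this series converges in $L^2(0,1)$ and $Z^H(t)\in E$, that is, $Z^H(t)$ coincides almost everywhere on $(0,1)$ with a (unique) element of $E$; this defines an $E$-valued random variable. Moreover, for every $p\in\mathbb N$, $$\sup_{t\ge0}\ \mathbb E\bigl[\|Z^H(t)\|_E^{2p}\bigr]<\infty .$$ -/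

import Mathlib

open MeasureTheory ProbabilityTheory
open scoped NNReal ENNReal

noncomputable section

namespace FracOU

/-- Lebesgue measure on the open interval `(0,1)`. -/
abbrev leb01 : Measure ℝ := volume.restrict (Set.Ioo (0 : ℝ) 1)

/-- The separable Hilbert space `L²((0,1); ℝ)`. -/
abbrev L2 : Type := Lp ℝ 2 leb01

/-- The Banach space `E = C([0,1]; ℝ)`, with the maximum norm. -/
abbrev E : Type := C(Set.Icc (0 : ℝ) 1, ℝ)

/-- The element `x` of `L²(0,1)` is (the class of) the continuous function `f` on `[0,1]`.
(`Set.IccExtend` only extends `f` to the real line; the values outside `(0,1)` play no role.) -/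
def Represents (x : L2) (f : E) : Prop :=
  (x : ℝ → ℝ) =ᵐ[leb01] Set.IccExtend zero_le_one f

/-- The eigenvalues `λ_k = k² π²`, `k = 1, 2, …`, of the Dirichlet Laplacian `-d²/dξ²` on `(0,1)`.
The index is shifted by one: `eigval k` is `λ_{k+1}`. -/
def eigval (k : ℕ) : ℝ := ((k : ℝ) + 1) ^ 2 * Real.pi ^ 2

/-- The eigenfunctions `ξ ↦ √2 sin(kπξ)`, `k = 1, 2, …` (index shifted by one). -/
def eigfun (k : ℕ) (ξ : ℝ) : ℝ := √2 * Real.sin (((k : ℝ) + 1) * Real.pi * ξ)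

theorem memLp_eigfun (k : ℕ) : MemLp (eigfun k) 2 leb01 := by
  have hc : Continuous (eigfun k) := by unfold eigfun; fun_prop
  refine MemLp.of_bound hc.aestronglyMeasurable (√2) (Filter.Eventually.of_forall fun ξ => ?_)
  unfold eigfun
  rw [norm_mul, Real.norm_of_nonneg (Real.sqrt_nonneg 2)]
  exact mul_le_of_le_one_right (Real.sqrt_nonneg 2) (Real.abs_sin_le_one _)

/-- The orthonormal system `(e_k)` as elements of `L²(0,1)` (index shifted by one). -/
def e (k : ℕ) : L2 := (memLp_eigfun k).toLp (eigfun k)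

/-- The heat semigroup `S(t) x = ∑_k exp(-λ_k t) ⟨x, e_k⟩ e_k`. -/
def S (t : ℝ) (x : L2) : L2 := ∑' k : ℕ, (Real.exp (-eigval k * t) * inner ℝ x (e k)) • e k

variable {Ω : Type*} [MeasurableSpace Ω]

/-- `β` is a real-valued fractional Brownian motion with Hurst index `H` under `P`:
a centered Gaussian process with covariance `(t^{2H} + s^{2H} - |t-s|^{2H})/2` and almost surely
continuous paths. -/
structure IsFBM (H : ℝ) (β : ℝ≥0 → Ω → ℝ) (P : Measure Ω) : Prop where
  gaussian : IsGaussianProcess β P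
  mean : ∀ t, ∫ ω, β t ω ∂P = 0
  cov : ∀ t s, ∫ ω, β t ω * β s ω ∂P =
    ((t : ℝ) ^ (2 * H) + (s : ℝ) ^ (2 * H) - |(t : ℝ) - (s : ℝ)| ^ (2 * H)) / 2
  continuous_paths : ∀ᵐ ω ∂P, Continuous fun t => β t ω

/-- For a deterministic integrand `φ` of class `C¹`, the stochastic integral
`∫₀ᵀ φ(s) dβ(s) = φ(T) β(T) - ∫₀ᵀ φ'(s) β(s) ds`. -/
def fracIntegral (φ : ℝ → ℝ) (β : ℝ≥0 → Ω → ℝ) (T : ℝ≥0) (ω : Ω) : ℝ :=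
  φ T * β T ω - ∫ s in (0 : ℝ)..T, deriv φ s * β s.toNNReal ω

/-- The terms, indexed by `(k, l)`, of the double series
`∑_{k,l} (∫₀ᵀ ⟨Θ(s) e_l, e_k⟩ dβ_l(s)) e_k`
which defines the stochastic integral `∫₀ᵀ Θ(s) dB(s)` with respect to the cylindrical process
`B = ∑_k β_k e_k`. -/
def cylTerm (Θ : ℝ → L2 → L2) (β : ℕ → ℝ≥0 → Ω → ℝ) (T : ℝ≥0) (ω : Ω) (kl : ℕ × ℕ) : L2 :=
  fracIntegral (fun s => inner ℝ (Θ s (e kl.2)) (e kl.1)) (β kl.2) T ω • e kl.1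

/-- The stochastic integral `∫₀ᵀ Θ(s) dB(s) = ∑_{k,l} (∫₀ᵀ ⟨Θ(s) e_l, e_k⟩ dβ_l(s)) e_k`. -/
def cylIntegral (Θ : ℝ → L2 → L2) (β : ℕ → ℝ≥0 → Ω → ℝ) (T : ℝ≥0) (ω : Ω) : L2 :=
  ∑' kl : ℕ × ℕ, cylTerm Θ β T ω kl

/-- The fractional Ornstein–Uhlenbeck process `Z(t) = ∫₀ᵗ S(t-s) dB(s)`. -/
def Z (β : ℕ → ℝ≥0 → Ω → ℝ) (t : ℝ≥0) (ω : Ω) : L2 :=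
  cylIntegral (fun s => S ((t : ℝ) - s)) β t ω

end FracOU

end

/-! The semigroup is diagonal in `e`, so `Z` is the series with independent coefficients z_k =
β_k(t) - ∫₀ᵗ λ_k exp(-λ_k(t-s)) β_k(s) ds. The kernel λ_k exp(-λ_k(t-s)) ds on [0,t], together with
an atom of mass exp(-λ_k t), is a probability measure. Hence z_k is an average of β_k(t) and of the
increments β_k(t) - β_k(s), and Jensen bounds its variance by a constant times λ_k^(-2H), uniformly
in t. Only increment variances enter, so both ranges of H are treated alike. Gaussianity and
independence are used on Riemann sums, and Fatou carries the moment bounds to z_k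
(`lintegral_sum_ouCoeff_le`).

For continuity in space, the series is cut into dyadic blocks of 2^j frequencies near 2^j. At a
point, such a block has variance at most of order (2^j)^(1-4H). Its sup norm is controlled by about
4^j grid values and by its coefficients (`norm_block_le`), so its moment of order 2m is at most of
order 4^j (2^j)^((1-4H)m). As 4H > 1, this is at most of order 2^(-j) once m is large
(`lintegral_ouBlock_le`). Minkowski's inequality then sums the blocks in E with a bound free of t,
and the sum represents `Z` (`represents_ouVersion`). -/

noncomputable section

namespace FracOU

/-! ### Riemann sums for `∫₀ᵗ exp(-λ(t-s)) dβ(s)` -/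

/-- The nodes `t i / (n + 1)` of the uniform partition of `[0, t]`. -/
def ouNode (t : ℝ≥0) (n i : ℕ) : ℝ≥0 := t * (i / (n + 1))

/-- The mass `∫ λ exp(-λ(t-s)) ds` of the `i`-th interval of the uniform partition. -/
def ouWeight (lam : ℝ) (t : ℝ≥0) (n i : ℕ) : ℝ :=
  Real.exp (-lam * (t - ouNode t n (i + 1))) - Real.exp (-lam * (t - ouNode t n i))

/-- Riemann sums for `b(t) - ∫₀ᵗ λ exp(-λ(t-s)) b(s) ds`. -/
def ouRiemann (lam : ℝ) (t : ℝ≥0) (n : ℕ) (b : ℝ≥0 → ℝ) : ℝ :=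
  b t - ∑ i ∈ Finset.range (n + 1), ouWeight lam t n i * b (ouNode t n (i + 1))

theorem ouNode_zero (t : ℝ≥0) (n : ℕ) : ouNode t n 0 = 0 := by simp [ouNode]

theorem ouNode_last (t : ℝ≥0) (n : ℕ) : ouNode t n (n + 1) = t := by
  simp [ouNode]

theorem ouNode_mono (t : ℝ≥0) (n : ℕ) : Monotone (ouNode t n) := by
  intro i j hij
  unfold ouNode
  gcongr

theorem coe_ouNode_succ_sub (t : ℝ≥0) (n i : ℕ) :
    (ouNode t n (i + 1) : ℝ) - ouNode t n i = t / (n + 1) := by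
  unfold ouNode
  push_cast
  ring

theorem ouNode_le {t : ℝ≥0} {n i : ℕ} (hi : i ≤ n + 1) : ouNode t n i ≤ t :=
  (ouNode_mono t n hi).trans_eq (ouNode_last t n)

theorem ouWeight_nonneg {lam : ℝ} (hlam : 0 ≤ lam) (t : ℝ≥0) (n i : ℕ) :
    0 ≤ ouWeight lam t n i := by
  have h : (ouNode t n i : ℝ) ≤ ouNode t n (i + 1) := by
    exact_mod_cast ouNode_mono t n (Nat.le_succ i)
  unfold ouWeight
  rw [sub_nonneg, Real.exp_le_exp]
  nlinarith

theorem sum_ouWeight (lam : ℝ) (t : ℝ≥0) (n : ℕ) :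
    ∑ i ∈ Finset.range (n + 1), ouWeight lam t n i = 1 - Real.exp (-lam * t) := by
  unfold ouWeight
  rw [Finset.sum_range_sub (fun i => Real.exp (-lam * ((t : ℝ) - ouNode t n i)))]
  simp [ouNode_last, ouNode_zero]

/-- The weights and exp(-λt) add up to 1, so b(t) can be spread over them. Only increments ending at
t remain, and their variances decay as the node approaches t. -/
theorem ouRiemann_eq (lam : ℝ) (t : ℝ≥0) (n : ℕ) (b : ℝ≥0 → ℝ) :
    ouRiemann lam t n b = Real.exp (-lam * t) * b t +
      ∑ i ∈ Finset.range (n + 1), ouWeight lam t n i * (b t - b (ouNode t n (i + 1))) := by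
  simp only [ouRiemann, mul_sub, Finset.sum_sub_distrib, ← Finset.sum_mul, sum_ouWeight]
  ring

/-- Jensen's inequality for the Riemann sums, whose weights form a probability vector. -/
theorem ouRiemann_sq_le {lam : ℝ} (hlam : 0 ≤ lam) (t : ℝ≥0) (n : ℕ) (b : ℝ≥0 → ℝ) :
    ouRiemann lam t n b ^ 2 ≤ Real.exp (-lam * t) * b t ^ 2 +
      ∑ i ∈ Finset.range (n + 1), ouWeight lam t n i * (b t - b (ouNode t n (i + 1))) ^ 2 := by
  set S := ∑ i ∈ Finset.range (n + 1), ouWeight lam t n i * (b t - b (ouNode t n (i + 1))) with hS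
  set Q := ∑ i ∈ Finset.range (n + 1),
    ouWeight lam t n i * (b t - b (ouNode t n (i + 1))) ^ 2 with hQ
  set m := Real.exp (-lam * t) * b t + S with hm
  -- The variance about the mean m is nonnegative; expanding the squares gives Jensen's inequality.
  have key : 0 ≤ Real.exp (-lam * t) * (b t - m) ^ 2 + ∑ i ∈ Finset.range (n + 1),
      ouWeight lam t n i * ((b t - b (ouNode t n (i + 1))) - m) ^ 2 := by
    refine add_nonneg (by positivity) (Finset.sum_nonneg fun i _ => ?_)
    exact mul_nonneg (ouWeight_nonneg hlam t n i) (sq_nonneg _)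
  have expand : ∑ i ∈ Finset.range (n + 1),
      ouWeight lam t n i * ((b t - b (ouNode t n (i + 1))) - m) ^ 2 =
      Q - 2 * m * S + m ^ 2 * (1 - Real.exp (-lam * t)) := by
    rw [hQ, hS, ← sum_ouWeight lam t n, Finset.mul_sum, Finset.mul_sum, ← Finset.sum_sub_distrib,
      ← Finset.sum_add_distrib]
    exact Finset.sum_congr rfl fun i _ => by ring
  rw [ouRiemann_eq]
  rw [expand] at key
  nlinarith

/-- Used with r = 2H and x = λu: the power costs only half of the decay exp(-λu). -/
theorem rpow_le_eight_mul_exp_half {x r : ℝ} (hx : 0 ≤ x) (hr : 0 ≤ r) (hr2 : r ≤ 2) :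
    x ^ r ≤ 8 * Real.exp (x / 2) := by
  have h1 : x ^ r ≤ 1 + x ^ 2 := by
    rcases le_total x 1 with h | h
    · exact (Real.rpow_le_one hx h hr).trans (by nlinarith)
    · have := Real.rpow_le_rpow_of_exponent_le h hr2
      rw [Real.rpow_two] at this
      linarith
  have h2 := Real.quadratic_le_exp_of_nonneg (x := x / 2) (by linarith)
  nlinarith

/-- Up to a constant, the weights integrate `|t - s|^{2H}` to `λ^{-2H}`. -/
theorem ouRiemann_variance_bound {lam : ℝ} (hlam : 0 < lam) {r : ℝ} (hr : 0 ≤ r) (hr2 : r ≤ 2)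
    (t : ℝ≥0) (n : ℕ) :
    Real.exp (-lam * t) * (t : ℝ) ^ r +
      ∑ i ∈ Finset.range (n + 1),
        ouWeight lam t n i * |(t : ℝ) - ouNode t n (i + 1)| ^ r ≤ 24 * lam ^ (-r) := by
  have scale : ∀ u : ℝ, 0 ≤ u → u ^ r ≤ 8 * lam ^ (-r) * Real.exp (lam * u / 2) := by
    intro u hu
    have h := rpow_le_eight_mul_exp_half (mul_nonneg hlam.le hu) hr hr2
    rw [Real.mul_rpow hlam.le hu] at h
    have h3 : lam ^ (-r) * (lam ^ r * u ^ r) = u ^ r := by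
      rw [← mul_assoc, ← Real.rpow_add hlam]; simp
    rw [← h3]
    calc lam ^ (-r) * (lam ^ r * u ^ r) ≤ lam ^ (-r) * (8 * Real.exp (lam * u / 2)) := by gcongr
      _ = _ := by ring
  have hpos : 0 ≤ 8 * lam ^ (-r) := by positivity
  have first : Real.exp (-lam * t) * (t : ℝ) ^ r ≤ 8 * lam ^ (-r) := by
    calc Real.exp (-lam * t) * (t : ℝ) ^ r
        ≤ Real.exp (-lam * t) * (8 * lam ^ (-r) * Real.exp (lam * t / 2)) := by
          gcongr; exact scale _ t.2
      _ = 8 * lam ^ (-r) * (Real.exp (-lam * t) * Real.exp (lam * t / 2)) := by ring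
      _ ≤ 8 * lam ^ (-r) * 1 := by
          gcongr
          rw [← Real.exp_add, Real.exp_le_one_iff]
          have : 0 ≤ lam * (t : ℝ) := mul_nonneg hlam.le t.2
          linarith
      _ = _ := mul_one _
  -- `G` is the square root of the exponential, so each weight is a difference of squares. Its
  -- factor `G (i + 1) + G i` is at most `2 * G (i + 1)`, which cancels the growth at the right node
  -- exactly. The rest telescopes to at most 2, whence 24 = 8 + 8 * 2 with no dependence on the
  -- mesh.
  set G : ℕ → ℝ := fun i => Real.exp (-lam * ((t : ℝ) - ouNode t n i) / 2) with hG
  have second : ∀ i ∈ Finset.range (n + 1),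
      ouWeight lam t n i * |(t : ℝ) - ouNode t n (i + 1)| ^ r ≤
        8 * lam ^ (-r) * (2 * (G (i + 1) - G i)) := by
    intro i hi
    have hle : (ouNode t n (i + 1) : ℝ) ≤ t := by
      exact_mod_cast ouNode_le (by have := Finset.mem_range.1 hi; omega)
    have hGm : G i ≤ G (i + 1) := by
      have h : (ouNode t n i : ℝ) ≤ ouNode t n (i + 1) := by
        exact_mod_cast ouNode_mono t n (Nat.le_succ i)
      simp only [hG, Real.exp_le_exp]
      nlinarith
    have hw : ouWeight lam t n i = G (i + 1) ^ 2 - G i ^ 2 := by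
      simp only [ouWeight, hG, ← Real.exp_nat_mul]
      congr 2 <;> push_cast <;> ring
    have hinv : Real.exp (lam * ((t : ℝ) - ouNode t n (i + 1)) / 2) * G (i + 1) = 1 := by
      simp only [hG, ← Real.exp_add]
      rw [Real.exp_eq_one_iff]; ring
    have hGpos : 0 < G i := Real.exp_pos _
    rw [abs_of_nonneg (sub_nonneg.2 hle)]
    calc ouWeight lam t n i * ((t : ℝ) - ouNode t n (i + 1)) ^ r
        ≤ ouWeight lam t n i *
            (8 * lam ^ (-r) * Real.exp (lam * ((t : ℝ) - ouNode t n (i + 1)) / 2)) := by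
          gcongr
          · exact ouWeight_nonneg hlam.le t n i
          · exact scale _ (sub_nonneg.2 hle)
      _ = 8 * lam ^ (-r) * (Real.exp (lam * ((t : ℝ) - ouNode t n (i + 1)) / 2) *
            ((G (i + 1) + G i) * (G (i + 1) - G i))) := by rw [hw]; ring
      _ ≤ 8 * lam ^ (-r) * (Real.exp (lam * ((t : ℝ) - ouNode t n (i + 1)) / 2) *
            ((2 * G (i + 1)) * (G (i + 1) - G i))) := by
          gcongr
          linarith
      _ = 8 * lam ^ (-r) * (2 * (G (i + 1) - G i)) *
            (Real.exp (lam * ((t : ℝ) - ouNode t n (i + 1)) / 2) * G (i + 1)) := by ring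
      _ = _ := by rw [hinv, mul_one]
  have tele : ∑ i ∈ Finset.range (n + 1), 8 * lam ^ (-r) * (2 * (G (i + 1) - G i)) ≤
      8 * lam ^ (-r) * 2 := by
    rw [← Finset.mul_sum, ← Finset.mul_sum, Finset.sum_range_sub]
    have h1 : G (n + 1) = 1 := by simp [hG, ouNode_last]
    have h0 : 0 < G 0 := Real.exp_pos _
    rw [h1]
    gcongr
    linarith
  have := Finset.sum_le_sum second
  linarith

/-- The weights are exact integrals of the kernel, so the only error is the oscillation of b on each
interval, which uniform continuity controls. -/
theorem tendsto_ouRiemann {lam : ℝ} (hlam : 0 ≤ lam) (t : ℝ≥0) {b : ℝ≥0 → ℝ}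
    (hb : Continuous b) :
    Filter.Tendsto (fun n => ouRiemann lam t n b) Filter.atTop
      (nhds (b t - ∫ s in (0 : ℝ)..t, lam * Real.exp (-lam * (t - s)) * b s.toNNReal)) := by
  refine Filter.Tendsto.sub tendsto_const_nhds ?_
  set B : ℝ → ℝ := fun s => b s.toNNReal with hB
  have hBc : Continuous B := hb.comp continuous_real_toNNReal
  set g : ℝ → ℝ := fun s => lam * Real.exp (-lam * (t - s)) with hg
  have hgc : Continuous g := by fun_prop
  have hgBc : Continuous fun s => g s * B s := hgc.mul hBc
  have hg0 : ∀ s, 0 ≤ g s := fun s => mul_nonneg hlam (Real.exp_pos _).le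
  have hw : ∀ n i, ouWeight lam t n i = ∫ s in (ouNode t n i : ℝ)..ouNode t n (i + 1), g s := by
    intro n i
    rw [intervalIntegral.integral_eq_sub_of_hasDerivAt
      (f := fun s : ℝ => Real.exp (-lam * ((t : ℝ) - s))) _ (hgc.intervalIntegrable _ _)]
    · rfl
    · intro s _
      have h : HasDerivAt (fun s : ℝ => -lam * ((t : ℝ) - s)) lam s := by
        simpa using ((hasDerivAt_id s).const_sub (t : ℝ)).const_mul (-lam)
      simpa [hg, mul_comm] using h.exp
  have hunif := (isCompact_Icc (a := (0 : ℝ)) (b := t)).uniformContinuousOn_of_continuous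
    hBc.continuousOn
  rw [Metric.uniformContinuousOn_iff] at hunif
  rw [Metric.tendsto_atTop]
  intro ε hε
  obtain ⟨δ, hδ, hδb⟩ := hunif (ε / 2) (by linarith)
  obtain ⟨N, hN⟩ := exists_nat_gt ((t : ℝ) / δ)
  refine ⟨N, fun n hn => ?_⟩
  have hmesh : (t : ℝ) / (n + 1) < δ := by
    have : (N : ℝ) ≤ n := by exact_mod_cast hn
    rw [div_lt_iff₀ (by positivity)]
    rw [div_lt_iff₀ hδ] at hN
    nlinarith
  have hsplit : ∫ s in (0 : ℝ)..t, g s * B s =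
      ∑ i ∈ Finset.range (n + 1), ∫ s in (ouNode t n i : ℝ)..ouNode t n (i + 1), g s * B s := by
    rw [intervalIntegral.sum_integral_adjacent_intervals
      (a := fun i => (ouNode t n i : ℝ)) fun i _ => hgBc.intervalIntegrable _ _]
    simp [ouNode_last, ouNode_zero]
  rw [hsplit, Real.dist_eq, ← Finset.sum_sub_distrib]
  have hterm : ∀ i ∈ Finset.range (n + 1),
      |ouWeight lam t n i * b (ouNode t n (i + 1)) -
        ∫ s in (ouNode t n i : ℝ)..ouNode t n (i + 1), g s * B s| ≤
      ε / 2 * ouWeight lam t n i := by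
    intro i hi
    have hi' : i + 1 ≤ n + 1 := by have := Finset.mem_range.1 hi; omega
    have hle : (ouNode t n i : ℝ) ≤ ouNode t n (i + 1) := by
      exact_mod_cast ouNode_mono t n (Nat.le_succ i)
    have hlet : (ouNode t n (i + 1) : ℝ) ≤ t := by exact_mod_cast ouNode_le hi'
    have hnode : b (ouNode t n (i + 1)) = B (ouNode t n (i + 1)) := by simp [hB]
    have hgcc : Continuous fun s => g s * B (ouNode t n (i + 1)) := hgc.mul continuous_const
    rw [hnode, hw, ← intervalIntegral.integral_mul_const, ← intervalIntegral.integral_sub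
      (hgcc.intervalIntegrable _ _) (hgBc.intervalIntegrable _ _), ← intervalIntegral.integral_const_mul,
      ← Real.norm_eq_abs]
    refine intervalIntegral.norm_integral_le_of_norm_le hle ?_
      ((continuous_const.mul hgc).intervalIntegrable _ _)
    refine Filter.Eventually.of_forall fun s hs => ?_
    have hs0 : 0 ≤ s := (ouNode t n i).2.trans hs.1.le
    have hd := hδb (ouNode t n (i + 1)) ⟨(ouNode t n (i + 1)).2, hlet⟩ s ⟨hs0, hs.2.trans hlet⟩ (by
      rw [Real.dist_eq, abs_of_nonneg (sub_nonneg.2 hs.2)]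
      have := coe_ouNode_succ_sub t n i
      have := hs.1
      linarith)
    rw [Real.dist_eq] at hd
    rw [← mul_sub, norm_mul, Real.norm_of_nonneg (hg0 s), Real.norm_eq_abs, mul_comm]
    exact mul_le_mul_of_nonneg_right hd.le (hg0 s)
  calc |∑ i ∈ Finset.range (n + 1), (ouWeight lam t n i * b (ouNode t n (i + 1)) -
        ∫ s in (ouNode t n i : ℝ)..ouNode t n (i + 1), g s * B s)|
      ≤ ∑ i ∈ Finset.range (n + 1), ε / 2 * ouWeight lam t n i :=
        (Finset.abs_sum_le_sum_abs _ _).trans (Finset.sum_le_sum hterm)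
    _ = ε / 2 * (1 - Real.exp (-lam * t)) := by rw [← Finset.mul_sum, sum_ouWeight]
    _ ≤ ε / 2 * 1 := by
        gcongr
        have := Real.exp_pos (-lam * (t : ℝ))
        linarith
    _ < ε := by linarith

variable {Ω : Type*} [MeasurableSpace Ω] {P : Measure Ω}

/-! ### Gaussian moments -/

/-- The absolute moment of order `2m` of a standard Gaussian variable. -/
def gaussMoment (m : ℕ) : ℝ≥0∞ := ∫⁻ x, ‖x‖ₑ ^ (2 * m) ∂gaussianReal 0 1

theorem gaussMoment_lt_top (m : ℕ) : gaussMoment m < ∞ := by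
  rcases Nat.eq_zero_or_pos m with rfl | hm
  · simp [gaussMoment]
  have h := (memLp_id_gaussianReal (μ := 0) (v := 1) ((2 * m : ℕ) : ℝ≥0)).eLpNorm_lt_top
  have h2 := lintegral_rpow_enorm_lt_top_of_eLpNorm_lt_top (by simp; omega)
    ENNReal.coe_ne_top h
  simpa [gaussMoment, ← ENNReal.rpow_natCast] using h2

theorem lintegral_gaussianReal_pow (v : ℝ≥0) (m : ℕ) :
    ∫⁻ x, ‖x‖ₑ ^ (2 * m) ∂gaussianReal 0 v = gaussMoment m * (v : ℝ≥0∞) ^ m := by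
  have h := gaussianReal_map_const_mul (μ := 0) (v := 1) (√v)
  have hv : (NNReal.mk (√(v : ℝ) ^ 2) (sq_nonneg _) * 1 : ℝ≥0) = v := by
    ext; simp
  rw [mul_zero, hv] at h
  rw [← h, lintegral_map (by fun_prop) (by fun_prop)]
  have hs : ‖√(v : ℝ)‖ₑ ^ 2 = v := by
    rw [← enorm_pow, Real.sq_sqrt v.coe_nonneg]
    simp
  simp only [enorm_mul, mul_pow, pow_mul, hs]
  rw [lintegral_const_mul _ (by fun_prop), mul_comm]
  simp [gaussMoment, pow_mul]

theorem lintegral_pow_of_hasGaussianLaw {Y : Ω → ℝ} (hY : HasGaussianLaw Y P)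
    (h0 : ∫ ω, Y ω ∂P = 0) (m : ℕ) :
    ∫⁻ ω, ‖Y ω‖ₑ ^ (2 * m) ∂P = gaussMoment m * ENNReal.ofReal (∫ ω, Y ω ^ 2 ∂P) ^ m := by
  have hm := hY.aemeasurable
  have hmap := hY.map_eq_gaussianReal
  rw [h0, variance_of_integral_eq_zero hm h0] at hmap
  have := lintegral_map' (μ := P) (f := fun x : ℝ => ‖x‖ₑ ^ (2 * m)) (by fun_prop) hm
  rw [← this, hmap, lintegral_gaussianReal_pow]
  rfl

/-! ### Second moments of the Riemann sums -/

namespace IsFBM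

variable {H : ℝ} {b : ℝ≥0 → Ω → ℝ}

theorem memLp (hb : IsFBM H b P) (t : ℝ≥0) : MemLp (b t) 2 P :=
  (hb.gaussian.hasGaussianLaw_eval t).memLp_two

theorem integral_sq (hb : IsFBM H b P) (hH : 0 < H) (t : ℝ≥0) :
    ∫ ω, b t ω ^ 2 ∂P = (t : ℝ) ^ (2 * H) := by
  have h := hb.cov t t
  simp only [sub_self, abs_zero, Real.zero_rpow (by positivity : 2 * H ≠ 0)] at h
  simp only [sq, h]
  ring

theorem integral_sub_sq (hb : IsFBM H b P) (hH : 0 < H) (t s : ℝ≥0) :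
    ∫ ω, (b t ω - b s ω) ^ 2 ∂P = |(t : ℝ) - s| ^ (2 * H) := by
  have h : ∀ ω, (b t ω - b s ω) ^ 2 = b t ω ^ 2 + b s ω ^ 2 - 2 * (b t ω * b s ω) :=
    fun ω => by ring
  have h1 : Integrable (fun ω => b t ω ^ 2) P := (hb.memLp t).integrable_sq
  have h2 : Integrable (fun ω => b s ω ^ 2) P := (hb.memLp s).integrable_sq
  have h3 : Integrable (fun ω => b t ω * b s ω) P := (hb.memLp t).integrable_mul (hb.memLp s)
  simp only [h]
  rw [integral_sub (by fun_prop) (h3.const_mul 2), integral_add h1 h2, integral_const_mul,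
    hb.integral_sq hH, hb.integral_sq hH, hb.cov]
  ring

theorem hasGaussianLaw_ouRiemann (hb : IsFBM H b P) (lam : ℝ) (t : ℝ≥0) (n : ℕ) :
    HasGaussianLaw (fun ω => ouRiemann lam t n fun s => b s ω) P := by
  -- Index 0 carries the term b(t); index i + 1 carries the i-th interval, sampled at its right
  -- node.
  let τ : ℕ → ℝ≥0 := fun i => if i = 0 then t else ouNode t n i
  let c : ℕ → ℝ := fun i => if i = 0 then 1 else -ouWeight lam t n (i - 1)
  have h := ((hb.gaussian.comp_right τ).smul c).hasGaussianLaw_fun_sum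
    (I := Finset.range (n + 1 + 1))
  have heq : ∀ ω, ∑ i ∈ Finset.range (n + 1 + 1), c i • (b ∘ τ) i ω =
      ouRiemann lam t n fun s => b s ω := fun ω => by
    rw [Finset.sum_range_succ']
    simp [ouRiemann, τ, c, add_comm, sub_eq_add_neg]
  simpa only [heq] using h

theorem integral_ouRiemann (hb : IsFBM H b P) (lam : ℝ) (t : ℝ≥0) (n : ℕ) :
    ∫ ω, ouRiemann lam t n (fun s => b s ω) ∂P = 0 := by
  have hi : ∀ s, Integrable (b s) P := fun s => (hb.gaussian.hasGaussianLaw_eval s).integrable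
  unfold ouRiemann
  rw [integral_sub (hi t) (integrable_finsetSum _ fun i _ => (hi _).const_mul _),
    integral_finsetSum _ fun i _ => (hi _).const_mul _]
  simp [integral_const_mul, hb.mean]

theorem integral_ouRiemann_sq_le (hb : IsFBM H b P) (hH : 0 < H) (hH1 : H ≤ 1) {lam : ℝ}
    (hlam : 0 < lam) (t : ℝ≥0) (n : ℕ) :
    ∫ ω, ouRiemann lam t n (fun s => b s ω) ^ 2 ∂P ≤ 24 * lam ^ (-(2 * H)) := by
  refine le_trans ?_ (ouRiemann_variance_bound hlam (by linarith) (by linarith) t n)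
  have h1 : Integrable (fun ω => Real.exp (-lam * t) * b t ω ^ 2) P :=
    (hb.memLp t).integrable_sq.const_mul _
  have h2 : ∀ i ∈ Finset.range (n + 1), Integrable (fun ω =>
      ouWeight lam t n i * (b t ω - b (ouNode t n (i + 1)) ω) ^ 2) P := fun i _ =>
    ((hb.memLp t).sub (hb.memLp _)).integrable_sq.const_mul _
  calc ∫ ω, ouRiemann lam t n (fun s => b s ω) ^ 2 ∂P
      ≤ ∫ ω, (Real.exp (-lam * t) * b t ω ^ 2 + ∑ i ∈ Finset.range (n + 1),
          ouWeight lam t n i * (b t ω - b (ouNode t n (i + 1)) ω) ^ 2) ∂P :=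
        integral_mono (hb.hasGaussianLaw_ouRiemann lam t n).memLp_two.integrable_sq
          (h1.add (integrable_finsetSum _ h2)) fun ω => ouRiemann_sq_le hlam.le t n _
    _ = _ := by
        rw [integral_add h1 (integrable_finsetSum _ h2), integral_finsetSum _ h2,
          integral_const_mul, hb.integral_sq hH]
        simp only [integral_const_mul, hb.integral_sub_sq hH]

end IsFBM

/-! ### Moments of the coefficients of the fractional Ornstein–Uhlenbeck process -/

/-- The coefficient `∫₀ᵗ exp(-λ_k(t-s)) dβ_k(s)` of `Z(t)`. -/
def ouCoeff (β : ℕ → ℝ≥0 → Ω → ℝ) (t : ℝ≥0) (k : ℕ) (ω : Ω) : ℝ :=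
  fracIntegral (fun s => Real.exp (-eigval k * (t - s))) (β k) t ω

theorem eigval_pos (k : ℕ) : 0 < eigval k := by unfold eigval; positivity

theorem tendsto_ouRiemann_ouCoeff {Ω : Type*} (β : ℕ → ℝ≥0 → Ω → ℝ) (t : ℝ≥0) (k : ℕ) {ω : Ω}
    (hc : Continuous fun s => β k s ω) :
    Filter.Tendsto (fun n => ouRiemann (eigval k) t n fun s => β k s ω) Filter.atTop
      (nhds (ouCoeff β t k ω)) := by
  have h := tendsto_ouRiemann (eigval_pos k).le t hc
  have hd : deriv (fun s : ℝ => Real.exp (-eigval k * (t - s))) =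
      fun s => eigval k * Real.exp (-eigval k * (t - s)) := by
    ext s
    have h : HasDerivAt (fun s : ℝ => -eigval k * ((t : ℝ) - s)) (eigval k) s := by
      simpa using ((hasDerivAt_id s).const_sub (t : ℝ)).const_mul (-eigval k)
    rw [h.exp.deriv, mul_comm]
  simpa only [ouCoeff, fracIntegral, hd, sub_self, mul_zero, Real.exp_zero, one_mul] using h

/-- The bound `24 λ_k^{-2H}` for the variance of the `k`-th coefficient. -/
def ouVar (H : ℝ) (k : ℕ) : ℝ := 24 * eigval k ^ (-(2 * H))

theorem ouVar_nonneg (H : ℝ) (k : ℕ) : 0 ≤ ouVar H k := by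
  have := eigval_pos k
  unfold ouVar; positivity

section

variable {H : ℝ} {β : ℕ → ℝ≥0 → Ω → ℝ}

theorem aemeasurable_ouCoeff (hβ : ∀ k, IsFBM H (β k) P) (t : ℝ≥0) (k : ℕ) :
    AEMeasurable (ouCoeff β t k) P :=
  aemeasurable_of_tendsto_metrizable_ae Filter.atTop
    (fun n => ((hβ k).hasGaussianLaw_ouRiemann (eigval k) t n).aemeasurable)
    ((hβ k).continuous_paths.mono fun _ h => tendsto_ouRiemann_ouCoeff β t k h)

theorem lintegral_sum_ouRiemann_le (hH : 0 < H) (hH1 : H ≤ 1) (hβ : ∀ k, IsFBM H (β k) P)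
    (hindep : iIndepFun (fun k ω t => β k t ω) P) (t : ℝ≥0) (n m : ℕ) (s : Finset ℕ) (c : ℕ → ℝ) :
    ∫⁻ ω, ‖∑ k ∈ s, c k * ouRiemann (eigval k) t n fun s => β k s ω‖ₑ ^ (2 * m) ∂P ≤
      gaussMoment m * ENNReal.ofReal (∑ k ∈ s, c k ^ 2 * ouVar H k) ^ m := by
  have : IsProbabilityMeasure P := (hβ 0).gaussian.isProbabilityMeasure
  let Y : ℕ → Ω → ℝ := fun k ω => c k * ouRiemann (eigval k) t n fun s => β k s ω
  have hYg : ∀ k, HasGaussianLaw (Y k) P := fun k =>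
    ((hβ k).hasGaussianLaw_ouRiemann (eigval k) t n).fun_smul (c k)
  -- A Riemann sum reads finitely many values of the path, so it is measurable for the product
  -- σ-algebra and inherits independence; the integral over a path need not be measurable there.
  have hYi : iIndepFun Y P := by
    refine hindep.comp (fun k b => c k * ouRiemann (eigval k) t n b) fun k => ?_
    unfold ouRiemann
    fun_prop
  have hY0 : ∀ k, ∫ ω, Y k ω ∂P = 0 := fun k => by
    simp only [Y]
    rw [integral_const_mul, (hβ k).integral_ouRiemann, mul_zero]
  have hsg : HasGaussianLaw (fun ω => ∑ k ∈ s, Y k ω) P := by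
    have h := (iIndepFun.hasGaussianLaw_fun_sum (X := fun (k : s) => Y k) (fun k => hYg k)
      (hYi.precomp Subtype.val_injective))
    have heq : ∀ ω, ∑ k : s, Y k ω = ∑ k ∈ s, Y k ω :=
      fun ω => Finset.sum_coe_sort s fun k => Y k ω
    simpa only [heq] using h
  have hs0 : ∫ ω, ∑ k ∈ s, Y k ω ∂P = 0 := by
    rw [integral_finsetSum _ fun k _ => (hYg k).integrable]
    simp [hY0]
  have hvar : ∫ ω, (∑ k ∈ s, Y k ω) ^ 2 ∂P ≤ ∑ k ∈ s, c k ^ 2 * ouVar H k := by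
    have h1 := variance_of_integral_eq_zero hsg.aemeasurable hs0
    have h2 := IndepFun.variance_sum (μ := P) (X := Y) (s := s) (fun k _ => (hYg k).memLp_two)
      fun i _ j _ hij => hYi.indepFun hij
    have h3 : (∑ k ∈ s, Y k) = fun ω => ∑ k ∈ s, Y k ω := by ext; simp
    rw [h3, h1] at h2
    rw [h2]
    refine Finset.sum_le_sum fun k _ => ?_
    rw [variance_of_integral_eq_zero (hYg k).aemeasurable (hY0 k)]
    simp only [Y, mul_pow]
    rw [integral_const_mul]
    exact mul_le_mul_of_nonneg_left
      ((hβ k).integral_ouRiemann_sq_le hH hH1 (eigval_pos k) t n) (sq_nonneg _)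
  rw [lintegral_pow_of_hasGaussianLaw hsg hs0]
  gcongr

/-- Moments of finite linear combinations of the coefficients, by Fatou's lemma. -/
theorem lintegral_sum_ouCoeff_le (hH : 0 < H) (hH1 : H ≤ 1) (hβ : ∀ k, IsFBM H (β k) P)
    (hindep : iIndepFun (fun k ω t => β k t ω) P) (t : ℝ≥0) (m : ℕ) (s : Finset ℕ) (c : ℕ → ℝ) :
    ∫⁻ ω, ‖∑ k ∈ s, c k * ouCoeff β t k ω‖ₑ ^ (2 * m) ∂P ≤
      gaussMoment m * ENNReal.ofReal (∑ k ∈ s, c k ^ 2 * ouVar H k) ^ m := by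
  have hlim : ∀ᵐ ω ∂P, Filter.Tendsto
      (fun n => ‖∑ k ∈ s, c k * ouRiemann (eigval k) t n fun s => β k s ω‖ₑ ^ (2 * m))
      Filter.atTop (nhds (‖∑ k ∈ s, c k * ouCoeff β t k ω‖ₑ ^ (2 * m))) := by
    have hc : ∀ᵐ ω ∂P, ∀ k, Continuous fun s => β k s ω :=
      ae_all_iff.2 fun k => (hβ k).continuous_paths
    filter_upwards [hc] with ω hω
    refine ((ENNReal.continuous_pow (2 * m)).tendsto _).comp (Filter.Tendsto.enorm ?_)
    exact tendsto_finsetSum _ fun k _ => (tendsto_ouRiemann_ouCoeff β t k (hω k)).const_mul _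
  calc ∫⁻ ω, ‖∑ k ∈ s, c k * ouCoeff β t k ω‖ₑ ^ (2 * m) ∂P
      = ∫⁻ ω, Filter.liminf (fun n =>
          ‖∑ k ∈ s, c k * ouRiemann (eigval k) t n fun s => β k s ω‖ₑ ^ (2 * m)) Filter.atTop ∂P :=
        lintegral_congr_ae (hlim.mono fun ω h => h.liminf_eq.symm)
    _ ≤ Filter.liminf (fun n => ∫⁻ ω,
          ‖∑ k ∈ s, c k * ouRiemann (eigval k) t n fun s => β k s ω‖ₑ ^ (2 * m) ∂P)
          Filter.atTop := by
        refine lintegral_liminf_le' fun n => ?_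
        have hm := fun k => ((hβ k).hasGaussianLaw_ouRiemann (eigval k) t n).aemeasurable
        fun_prop
    _ ≤ Filter.liminf (fun _ : ℕ => gaussMoment m *
          ENNReal.ofReal (∑ k ∈ s, c k ^ 2 * ouVar H k) ^ m) Filter.atTop :=
        Filter.liminf_le_liminf (Filter.Eventually.of_forall fun n =>
          lintegral_sum_ouRiemann_le hH hH1 hβ hindep t n m s c)
    _ = _ := Filter.liminf_const _

end

/-! ### The eigenbasis and the diagonal structure of the stochastic convolution -/

theorem integral_cos_int_mul_pi {n : ℤ} (hn : n ≠ 0) :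
    ∫ x in (0 : ℝ)..1, Real.cos (n * Real.pi * x) = 0 := by
  have hc : (n : ℝ) * Real.pi ≠ 0 := mul_ne_zero (by exact_mod_cast hn) Real.pi_ne_zero
  rw [intervalIntegral.integral_comp_mul_left (fun x => Real.cos x) hc, integral_cos]
  simp [Real.sin_int_mul_pi]

theorem integral_eigfun_mul_eigfun (k l : ℕ) :
    ∫ x in (0 : ℝ)..1, eigfun k x * eigfun l x = if k = l then 1 else 0 := by
  -- The 2 in `k + l + 2` comes from the index shift and keeps this frequency nonzero.
  have h : ∀ x, eigfun k x * eigfun l x =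
      Real.cos (((k - l : ℤ) : ℝ) * Real.pi * x) -
        Real.cos (((k + l + 2 : ℤ) : ℝ) * Real.pi * x) := by
    intro x
    have h1 : ((k - l : ℤ) : ℝ) * Real.pi * x =
        ((k : ℝ) + 1) * Real.pi * x - ((l : ℝ) + 1) * Real.pi * x := by push_cast; ring
    have h2 : ((k + l + 2 : ℤ) : ℝ) * Real.pi * x =
        ((k : ℝ) + 1) * Real.pi * x + ((l : ℝ) + 1) * Real.pi * x := by push_cast; ring
    rw [h1, h2, Real.cos_sub, Real.cos_add]
    have h3 : √2 * √2 = (2 : ℝ) := Real.mul_self_sqrt (by norm_num)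
    unfold eigfun
    linear_combination Real.sin (((k : ℝ) + 1) * Real.pi * x) *
      Real.sin (((l : ℝ) + 1) * Real.pi * x) * h3
  simp only [h]
  rw [intervalIntegral.integral_sub (Continuous.intervalIntegrable (by fun_prop) _ _)
    (Continuous.intervalIntegrable (by fun_prop) _ _),
    integral_cos_int_mul_pi (n := k + l + 2) (by omega)]
  split_ifs with hkl
  · simp [hkl]
  · rw [integral_cos_int_mul_pi (by omega), sub_zero]

theorem inner_e (k l : ℕ) : inner ℝ (e k) (e l) = if k = l then (1 : ℝ) else 0 := by
  rw [← integral_eigfun_mul_eigfun, L2.inner_def,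
    intervalIntegral.integral_of_le zero_le_one, integral_Ioc_eq_integral_Ioo]
  refine integral_congr_ae ?_
  filter_upwards [(memLp_eigfun k).coeFn_toLp, (memLp_eigfun l).coeFn_toLp] with x hk hl
  simp only [e, hk, hl]
  simp [mul_comm]

theorem orthonormal_e : Orthonormal ℝ e := orthonormal_iff_ite.2 inner_e

theorem norm_e (k : ℕ) : ‖e k‖ = 1 := orthonormal_e.1 k

theorem S_e (r : ℝ) (l : ℕ) : S r (e l) = Real.exp (-eigval l * r) • e l := by
  unfold S
  rw [tsum_eq_single l fun k hk => by simp [inner_e, hk.symm]]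
  simp [norm_e]

section

variable {Ω : Type*} (β : ℕ → ℝ≥0 → Ω → ℝ) (t : ℝ≥0) (ω : Ω)

theorem cylTerm_diag (k : ℕ) :
    cylTerm (fun s => S ((t : ℝ) - s)) β t ω (k, k) = ouCoeff β t k ω • e k := by
  simp [cylTerm, S_e, inner_smul_left, norm_e, ouCoeff]

theorem cylTerm_off_diag {k l : ℕ} (h : k ≠ l) :
    cylTerm (fun s => S ((t : ℝ) - s)) β t ω (k, l) = 0 := by
  simp [cylTerm, S_e, inner_smul_left, inner_e, h.symm, fracIntegral]

theorem diag_injective : Function.Injective fun k : ℕ => (k, k) :=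
  fun _ _ h => (Prod.mk.inj h).1

theorem support_cylTerm_subset :
    Function.support (cylTerm (fun s => S ((t : ℝ) - s)) β t ω) ⊆
      Set.range fun k : ℕ => (k, k) := by
  rintro ⟨k, l⟩ hkl
  by_contra h
  refine hkl (cylTerm_off_diag β t ω fun hk => h ⟨k, by simp [hk]⟩)

variable {β t ω}

theorem summable_smul_e {a : ℕ → ℝ} (h : Summable fun k => a k ^ 2) :
    Summable fun k => a k • e k := by
  have := orthonormal_e.orthogonalFamily.summable_iff_norm_sq_summable a
  simpa using this.2 (by simpa using h)

theorem summable_cylTerm (h : Summable fun k => ouCoeff β t k ω ^ 2) :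
    Summable (cylTerm (fun s => S ((t : ℝ) - s)) β t ω) := by
  refine (diag_injective.summable_iff fun x hx => ?_).1 ?_
  · by_contra h0
    exact hx (support_cylTerm_subset β t ω h0)
  · exact (summable_smul_e h).congr fun k => (cylTerm_diag β t ω k).symm

theorem Z_eq_tsum : Z β t ω = ∑' k, ouCoeff β t k ω • e k := by
  unfold Z cylIntegral
  rw [← diag_injective.tsum_eq (support_cylTerm_subset β t ω)]
  exact tsum_congr fun k => cylTerm_diag β t ω k

end

/-! ### The embedding of `C([0,1])` into `L²(0,1)` -/

theorem continuous_IccExtend (f : E) : Continuous (Set.IccExtend zero_le_one f) :=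
  f.continuous.Icc_extend'

theorem memLp_IccExtend (f : E) : MemLp (Set.IccExtend zero_le_one f) 2 leb01 :=
  MemLp.of_bound (continuous_IccExtend f).aestronglyMeasurable ‖f‖
    (Filter.Eventually.of_forall fun _ => f.norm_coe_le_norm _)

/-- The class in `L²(0,1)` of a continuous function on `[0,1]`. -/
def toL2 : E →L[ℝ] L2 :=
  LinearMap.mkContinuous
    { toFun := fun f => (memLp_IccExtend f).toLp _
      map_add' := fun f g => by
        rw [← MemLp.toLp_add]; rfl
      map_smul' := fun c f => by
        rw [RingHom.id_apply, ← MemLp.toLp_const_smul]; rfl } 1 fun f => by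
    rw [one_mul]
    have h := Lp.norm_le_of_ae_bound (f := (memLp_IccExtend f).toLp _) (norm_nonneg f) (by
      filter_upwards [(memLp_IccExtend f).coeFn_toLp] with x hx
      rw [hx]
      exact f.norm_coe_le_norm _)
    simpa [measureUnivNNReal] using h

/-- As an equation under a continuous linear map, the relation can be checked by passing to limits
of series in E. -/
theorem represents_iff {x : L2} {f : E} : Represents x f ↔ toL2 f = x := by
  have h : toL2 f = (memLp_IccExtend f).toLp _ := rfl
  rw [h, Lp.ext_iff]
  constructor
  · intro hx
    exact (memLp_IccExtend f).coeFn_toLp.trans hx.symm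
  · intro hx
    exact hx.symm.trans (memLp_IccExtend f).coeFn_toLp

/-- The eigenfunctions as elements of `C([0,1])`. -/
def eE (k : ℕ) : E := ⟨fun x => eigfun k x, by unfold eigfun; fun_prop⟩

theorem toL2_eE (k : ℕ) : toL2 (eE k) = e k := by
  refine represents_iff.1 ?_
  unfold Represents
  filter_upwards [(memLp_eigfun k).coeFn_toLp, ae_restrict_mem measurableSet_Ioo] with x hx hx1
  rw [e, hx, Set.IccExtend_of_mem _ _ (Set.Ioo_subset_Icc_self hx1)]
  rfl

/-! ### Random series with geometrically decaying moments -/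

section

variable {Ω : Type*} [MeasurableSpace Ω] {P : Measure Ω}
  {F : Type*} [NormedAddCommGroup F] {D : ℕ → Ω → F} {A : ℝ≥0∞} {q : ℕ}

theorem eLpNorm_pow_nat (hq : q ≠ 0) (f : Ω → F) :
    eLpNorm f q P ^ q = ∫⁻ ω, ‖f ω‖ₑ ^ q ∂P := by
  have hq' : (q : ℝ) ≠ 0 := by exact_mod_cast hq
  rw [eLpNorm_eq_lintegral_rpow_enorm_toReal (by exact_mod_cast hq) (by simp),
    ← ENNReal.rpow_natCast, ← ENNReal.rpow_mul]
  simp [hq']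

/-- The bound for the `L^q` norm of a series whose `j`-th term has `q`-th moment
at most `A 2^{-j}`. -/
def seriesBound (A : ℝ≥0∞) (q : ℕ) : ℝ≥0∞ :=
  A ^ (1 / q : ℝ) * (1 - (1 / 2 : ℝ≥0∞) ^ (1 / q : ℝ))⁻¹

theorem seriesBound_lt_top (hq : q ≠ 0) (hA : A < ∞) : seriesBound A q < ∞ := by
  have hq' : 0 < (1 / q : ℝ) := by positivity
  refine ENNReal.mul_lt_top (ENNReal.rpow_lt_top_of_nonneg hq'.le hA.ne) ?_
  rw [ENNReal.inv_lt_top, tsub_pos_iff_lt]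
  exact ENNReal.rpow_lt_one (by simp) hq'

/-- Taking q-th roots leaves a geometric series of ratio 2^(-1/q) < 1. -/
theorem tsum_eLpNorm_le (hq : q ≠ 0)
    (hmom : ∀ j, ∫⁻ ω, ‖D j ω‖ₑ ^ q ∂P ≤ A * (1 / 2) ^ j) :
    ∑' j, eLpNorm (D j) q P ≤ seriesBound A q := by
  have hq' : (q : ℝ) ≠ 0 := by exact_mod_cast hq
  have h : ∀ j, eLpNorm (D j) q P ≤
      A ^ (1 / q : ℝ) * ((1 / 2 : ℝ≥0∞) ^ (1 / q : ℝ)) ^ j := by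
    intro j
    have h1 : eLpNorm (D j) q P = (eLpNorm (D j) q P ^ q) ^ (1 / q : ℝ) := by
      rw [← ENNReal.rpow_natCast, ← ENNReal.rpow_mul]
      simp [hq']
    rw [h1, eLpNorm_pow_nat hq]
    calc (∫⁻ ω, ‖D j ω‖ₑ ^ q ∂P) ^ (1 / q : ℝ)
        ≤ (A * (1 / 2) ^ j) ^ (1 / q : ℝ) := by
          gcongr
          exact hmom j
      _ = _ := by
          rw [ENNReal.mul_rpow_of_nonneg _ _ (by positivity), ← ENNReal.rpow_natCast,
            ← ENNReal.rpow_natCast, ← ENNReal.rpow_mul, ← ENNReal.rpow_mul, mul_comm (j : ℝ)]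
  refine (ENNReal.tsum_le_tsum h).trans ?_
  rw [ENNReal.tsum_mul_left, ENNReal.tsum_geometric, seriesBound]

/-- On a probability space the L¹ norm is at most the L^q norm, so the sum of the norms has finite
expectation. -/
theorem ae_summable_of_moments [CompleteSpace F] [IsProbabilityMeasure P] (hq : q ≠ 0)
    (hA : A < ∞) (hD : ∀ j, AEStronglyMeasurable (D j) P)
    (hmom : ∀ j, ∫⁻ ω, ‖D j ω‖ₑ ^ q ∂P ≤ A * (1 / 2) ^ j) :
    ∀ᵐ ω ∂P, Summable fun j => D j ω := by
  have h1 : ∫⁻ ω, ∑' j, ‖D j ω‖ₑ ∂P < ∞ := by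
    rw [lintegral_tsum fun j => (hD j).enorm]
    refine lt_of_le_of_lt ?_ (seriesBound_lt_top hq hA)
    refine le_trans (ENNReal.tsum_le_tsum fun j => ?_) (tsum_eLpNorm_le hq hmom)
    rw [← eLpNorm_one_eq_lintegral_enorm]
    exact eLpNorm_le_eLpNorm_of_exponent_le (by exact_mod_cast Nat.one_le_iff_ne_zero.2 hq) (hD j)
  filter_upwards [ae_lt_top' (AEMeasurable.tsum fun j => (hD j).enorm) h1.ne]
    with ω hω
  refine Summable.of_norm ?_
  have := ENNReal.summable_toReal hω.ne
  simpa using this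

/-- Minkowski's inequality bounds the partial sums, and lower semicontinuity of the L^q norm passes
to the limit. -/
theorem lintegral_tsum_pow_le (hq : q ≠ 0)
    (hD : ∀ j, AEStronglyMeasurable (D j) P)
    (hmom : ∀ j, ∫⁻ ω, ‖D j ω‖ₑ ^ q ∂P ≤ A * (1 / 2) ^ j)
    (hsum : ∀ᵐ ω ∂P, Summable fun j => D j ω) :
    ∫⁻ ω, ‖∑' j, D j ω‖ₑ ^ q ∂P ≤ seriesBound A q ^ q := by
  rw [← eLpNorm_pow_nat hq]
  gcongr
  refine (Lp.eLpNorm_lim_le_liminf_eLpNorm (f := fun n => ∑ j ∈ Finset.range n, D j)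
    (fun _ => Finset.aestronglyMeasurable_sum _ fun j _ => hD j) _ ?_).trans ?_
  · filter_upwards [hsum] with ω hω
    simpa using hω.hasSum.tendsto_sum_nat
  · refine (Filter.liminf_le_liminf (v := fun _ => seriesBound A q)
      (Filter.Eventually.of_forall fun _ => ?_)).trans_eq (Filter.liminf_const _)
    refine (eLpNorm_sum_le (fun j _ => hD j)
      (by exact_mod_cast Nat.one_le_iff_ne_zero.2 hq)).trans ?_
    exact (ENNReal.sum_le_tsum _).trans (tsum_eLpNorm_le hq hmom)

theorem aestronglyMeasurable_tsum (hD : ∀ j, AEStronglyMeasurable (D j) P)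
    (hsum : ∀ᵐ ω ∂P, Summable fun j => D j ω) :
    AEStronglyMeasurable (fun ω => ∑' j, D j ω) P :=
  aestronglyMeasurable_of_tendsto_ae Filter.atTop
    (f := fun n ω => ∑ j ∈ Finset.range n, D j ω)
    (fun _ => Finset.aestronglyMeasurable_fun_sum _ fun j _ => hD j)
    (hsum.mono fun _ h => h.hasSum.tendsto_sum_nat)

end

/-! ### Dyadic blocks of sine series -/

/-- The indices `k` with `2^j ≤ k + 1 < 2^{j+1}`. -/
def dyadicBlock (j : ℕ) : Finset ℕ := Finset.Ico (2 ^ j - 1) (2 ^ (j + 1) - 1)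

theorem card_dyadicBlock (j : ℕ) : (dyadicBlock j).card = 2 ^ j := by
  have := Nat.one_le_two_pow (n := j)
  rw [dyadicBlock, Nat.card_Ico, pow_succ]
  omega

theorem le_of_mem_dyadicBlock {j k : ℕ} (hk : k ∈ dyadicBlock j) :
    (2 : ℝ) ^ j ≤ (k : ℝ) + 1 := by
  have h := (Finset.mem_Ico.1 hk).1
  have : 2 ^ j ≤ k + 1 := by omega
  exact_mod_cast this

theorem lt_of_mem_dyadicBlock {j k : ℕ} (hk : k ∈ dyadicBlock j) :
    (k : ℝ) + 1 ≤ 2 * 2 ^ j := by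
  have h := (Finset.mem_Ico.1 hk).2
  have : k + 1 ≤ 2 * 2 ^ j := by rw [pow_succ] at h; omega
  exact_mod_cast this

theorem sum_dyadicBlock {G : Type*} [AddCommMonoid G] (f : ℕ → G) (J : ℕ) :
    ∑ j ∈ Finset.range J, ∑ k ∈ dyadicBlock j, f k = ∑ k ∈ Finset.range (2 ^ J - 1), f k := by
  induction J with
  | zero => simp
  | succ J ih =>
    have h : 2 ^ J - 1 ≤ 2 ^ (J + 1) - 1 := by rw [pow_succ]; omega
    rw [Finset.sum_range_succ, ih, dyadicBlock, Finset.range_eq_Ico, Finset.range_eq_Ico,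
      Finset.sum_Ico_consecutive _ (Nat.zero_le _) h]

theorem abs_eigfun_sub_le (k : ℕ) (x y : ℝ) :
    |eigfun k x - eigfun k y| ≤ 5 * ((k : ℝ) + 1) * |x - y| := by
  have h1 : √2 * Real.pi ≤ 5 := by
    have h2 : √2 ≤ 1.5 := Real.sqrt_le_iff.2 (by norm_num)
    have := Real.pi_lt_d2
    have := Real.pi_pos
    nlinarith [Real.sqrt_nonneg 2]
  have h3 := Real.abs_sin_sub_sin_le (((k : ℝ) + 1) * Real.pi * x) (((k : ℝ) + 1) * Real.pi * y)
  unfold eigfun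
  rw [← mul_sub, abs_mul, abs_of_nonneg (Real.sqrt_nonneg 2)]
  rw [← mul_sub, abs_mul,
    abs_of_nonneg (by positivity : 0 ≤ ((k : ℝ) + 1) * Real.pi)] at h3
  calc √2 * |Real.sin (((k : ℝ) + 1) * Real.pi * x) - Real.sin (((k : ℝ) + 1) * Real.pi * y)|
      ≤ √2 * (((k : ℝ) + 1) * Real.pi * |x - y|) := by gcongr
    _ = (√2 * Real.pi) * (((k : ℝ) + 1) * |x - y|) := by ring
    _ ≤ 5 * (((k : ℝ) + 1) * |x - y|) := by gcongr
    _ = _ := by ring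

/-- The point `i / 4^j`, truncated to `[0, 1]`. -/
def gridPoint (j i : ℕ) : Set.Icc (0 : ℝ) 1 := Set.projIcc 0 1 zero_le_one (i / 4 ^ j)

theorem exists_gridPoint_near (j : ℕ) (x : Set.Icc (0 : ℝ) 1) :
    ∃ i ∈ Finset.range (4 ^ j + 1), |(x : ℝ) - gridPoint j i| ≤ 1 / 4 ^ j := by
  have hM : (0 : ℝ) < 4 ^ j := by positivity
  have hx0 : 0 ≤ (x : ℝ) * 4 ^ j := mul_nonneg x.2.1 hM.le
  have hfl := Nat.floor_le hx0
  have hlt := Nat.lt_floor_add_one ((x : ℝ) * 4 ^ j)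
  have hxM : (x : ℝ) * 4 ^ j ≤ 4 ^ j := mul_le_of_le_one_left hM.le x.2.2
  refine ⟨⌊(x : ℝ) * 4 ^ j⌋₊, ?_, ?_⟩
  · have : (⌊(x : ℝ) * 4 ^ j⌋₊ : ℝ) ≤ ((4 ^ j : ℕ) : ℝ) := by push_cast; linarith
    have : ⌊(x : ℝ) * 4 ^ j⌋₊ ≤ 4 ^ j := by exact_mod_cast this
    exact Finset.mem_range.2 (by omega)
  · have hmem : ((⌊(x : ℝ) * 4 ^ j⌋₊ : ℝ) / 4 ^ j) ∈ Set.Icc (0 : ℝ) 1 :=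
      ⟨by positivity, (div_le_one hM).2 (hfl.trans hxM)⟩
    rw [gridPoint, Set.projIcc_of_mem _ hmem]
    have h1 : (⌊(x : ℝ) * 4 ^ j⌋₊ : ℝ) / 4 ^ j ≤ x := (div_le_iff₀ hM).2 hfl
    rw [abs_of_nonneg (sub_nonneg.2 h1), le_div_iff₀ hM, sub_mul, div_mul_cancel₀ _ hM.ne']
    linarith

/-- The sup norm of a dyadic block of a sine series is controlled by its values on a grid and by
its coefficients. -/
theorem norm_block_le (a : ℕ → ℝ) (j : ℕ) :
    ∃ i ∈ Finset.range (4 ^ j + 1), ∃ k ∈ dyadicBlock j,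
      ‖∑ k ∈ dyadicBlock j, a k • eE k‖ ≤
        |∑ k ∈ dyadicBlock j, eigfun k (gridPoint j i) * a k| + 10 * |a k| := by
  have hne : (dyadicBlock j).Nonempty := by
    rw [← Finset.card_pos, card_dyadicBlock]; positivity
  obtain ⟨k₀, hk₀, hmax⟩ := Finset.exists_max_image (dyadicBlock j) (fun k => |a k|) hne
  set f : E := ∑ k ∈ dyadicBlock j, a k • eE k with hf
  have hfx : ∀ x : Set.Icc (0 : ℝ) 1, f x = ∑ k ∈ dyadicBlock j, eigfun k x * a k := by
    intro x
    simp [hf, eE, mul_comm]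
  obtain ⟨x, hx⟩ : ∃ x, ‖f‖ ≤ ‖f x‖ := by
    obtain ⟨x, -, hx⟩ := isCompact_univ.exists_isMaxOn (Set.univ_nonempty)
      (f.continuous.norm.continuousOn (s := Set.univ))
    exact ⟨x, (f.norm_le (norm_nonneg _)).2 fun y => hx (Set.mem_univ y)⟩
  obtain ⟨i, hi, hxi⟩ := exists_gridPoint_near j x
  refine ⟨i, hi, k₀, hk₀, hx.trans ?_⟩
  have hN : (0 : ℝ) < 2 ^ j := by positivity
  have h4 : (4 : ℝ) ^ j = 2 ^ j * 2 ^ j := by rw [← mul_pow]; norm_num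
  -- Each of the 2^j terms has Lipschitz constant at most 5 * (2 * 2^j) times the largest
  -- coefficient. The mesh 4^(-j) compensates both the frequency and the number of terms.
  have hdiff : |f x - f (gridPoint j i)| ≤ 10 * |a k₀| := by
    rw [hfx, hfx, ← Finset.sum_sub_distrib]
    calc |∑ k ∈ dyadicBlock j, (eigfun k x * a k - eigfun k (gridPoint j i) * a k)|
        ≤ ∑ k ∈ dyadicBlock j, |eigfun k x * a k - eigfun k (gridPoint j i) * a k| :=
          Finset.abs_sum_le_sum_abs _ _
      _ ≤ ∑ _k ∈ dyadicBlock j, 10 * |a k₀| / 2 ^ j := by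
          refine Finset.sum_le_sum fun k hk => ?_
          rw [← sub_mul, abs_mul]
          calc |eigfun k x - eigfun k (gridPoint j i)| * |a k|
              ≤ (5 * (2 * 2 ^ j) * (1 / 4 ^ j)) * |a k₀| := by
                refine mul_le_mul ((abs_eigfun_sub_le k _ _).trans ?_) (hmax k hk)
                  (abs_nonneg _) (by positivity)
                gcongr
                exact lt_of_mem_dyadicBlock hk
            _ = 10 * |a k₀| / 2 ^ j := by rw [h4]; field_simp; ring
      _ = 10 * |a k₀| := by
          rw [Finset.sum_const, card_dyadicBlock, nsmul_eq_mul]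
          push_cast
          field_simp
  rw [Real.norm_eq_abs, ← hfx]
  have := abs_sub_abs_le_abs_sub (f x) (f (gridPoint j i))
  linarith

theorem add_pow_le_two_pow_mul (a b : ℝ≥0∞) (n : ℕ) : (a + b) ^ n ≤ 2 ^ n * (a ^ n + b ^ n) := by
  rcases le_total a b with h | h
  · calc (a + b) ^ n ≤ (b + b) ^ n := by gcongr
      _ = 2 ^ n * b ^ n := by rw [← two_mul, mul_pow]
      _ ≤ _ := by gcongr; exact le_add_self
  · calc (a + b) ^ n ≤ (a + a) ^ n := by gcongr
      _ = 2 ^ n * a ^ n := by rw [← two_mul, mul_pow]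
      _ ≤ _ := by gcongr; exact le_self_add

/-- The optimal grid point and index depend on the coefficients, hence later on ω; summing over all
of them gives a bound that can be integrated term by term. -/
theorem enorm_block_pow_le (a : ℕ → ℝ) (j n : ℕ) :
    ‖∑ k ∈ dyadicBlock j, a k • eE k‖ₑ ^ n ≤
      2 ^ n * (∑ i ∈ Finset.range (4 ^ j + 1),
          ‖∑ k ∈ dyadicBlock j, eigfun k (gridPoint j i) * a k‖ₑ ^ n +
        10 ^ n * ∑ k ∈ dyadicBlock j, ‖a k‖ₑ ^ n) := by
  obtain ⟨i, hi, k, hk, h⟩ := norm_block_le a j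
  have h1 : ‖∑ k ∈ dyadicBlock j, a k • eE k‖ₑ ≤
      ‖∑ k ∈ dyadicBlock j, eigfun k (gridPoint j i) * a k‖ₑ + 10 * ‖a k‖ₑ := by
    have h10 : (10 : ℝ≥0∞) = ‖(10 : ℝ)‖ₑ := by
      rw [Real.enorm_eq_ofReal (by norm_num)]; simp
    rw [h10, ← enorm_mul, ← ofReal_norm, ← ofReal_norm, ← ofReal_norm,
      ← ENNReal.ofReal_add (norm_nonneg _) (norm_nonneg _)]
    refine ENNReal.ofReal_le_ofReal ?_
    simpa using h
  refine (pow_le_pow_left' h1 n).trans ((add_pow_le_two_pow_mul _ _ n).trans ?_)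
  rw [mul_pow]
  gcongr
  · exact Finset.single_le_sum (f := fun i =>
      ‖∑ k ∈ dyadicBlock j, eigfun k (gridPoint j i) * a k‖ₑ ^ n) (fun _ _ => zero_le) hi
  · exact Finset.single_le_sum (f := fun k => ‖a k‖ₑ ^ n) (fun _ _ => zero_le) hk

/-! ### Moments of the dyadic blocks and the continuous version -/

section

variable {Ω : Type*} [MeasurableSpace Ω] {P : Measure Ω} {H : ℝ} {β : ℕ → ℝ≥0 → Ω → ℝ}

theorem ouVar_le (hH : 0 < H) {k : ℕ} {N : ℝ} (hN : 0 < N) (hk : N ≤ (k : ℝ) + 1) :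
    ouVar H k ≤ 24 * N ^ (-(4 * H)) := by
  have h1 : N ^ 2 ≤ eigval k := by
    have hpi : 1 ≤ Real.pi ^ 2 := by nlinarith [Real.pi_gt_three]
    calc N ^ 2 ≤ ((k : ℝ) + 1) ^ 2 * 1 := by rw [mul_one]; gcongr
      _ ≤ _ := by unfold eigval; gcongr
  have h2 : (N ^ 2) ^ (-(2 * H)) = N ^ (-(4 * H)) := by
    rw [← Real.rpow_natCast, ← Real.rpow_mul hN.le]
    congr 1; push_cast; ring
  unfold ouVar
  rw [← h2]
  gcongr 24 * ?_
  exact Real.rpow_le_rpow_of_nonpos (by positivity) h1 (by linarith)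

theorem summable_ouVar (hH : 1 / 4 < H) : Summable (ouVar H) := by
  have h : Summable fun k : ℕ => 24 * ((k : ℝ) + 1) ^ (-(4 * H)) := by
    have := (summable_nat_add_iff 1).2
      (Real.summable_nat_rpow (p := -(4 * H)) |>.2 (by linarith))
    simpa using this.mul_left 24
  refine h.of_nonneg_of_le (ouVar_nonneg H) fun k => ?_
  exact ouVar_le (by linarith) (by positivity) le_rfl

theorem eigfun_sq_le (k : ℕ) (x : ℝ) : eigfun k x ^ 2 ≤ 2 := by
  unfold eigfun
  rw [mul_pow, Real.sq_sqrt zero_le_two]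
  nlinarith [Real.sin_sq_le_one (((k : ℝ) + 1) * Real.pi * x)]

theorem sum_dyadicBlock_ouVar_le (hH : 0 < H) (j : ℕ) (x : ℝ) :
    ∑ k ∈ dyadicBlock j, eigfun k x ^ 2 * ouVar H k ≤ 48 * ((2 : ℝ) ^ j) ^ (1 - 4 * H) := by
  have hN : (0 : ℝ) < 2 ^ j := by positivity
  calc ∑ k ∈ dyadicBlock j, eigfun k x ^ 2 * ouVar H k
      ≤ ∑ _k ∈ dyadicBlock j, 2 * (24 * ((2 : ℝ) ^ j) ^ (-(4 * H))) := by
        refine Finset.sum_le_sum fun k hk => ?_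
        exact mul_le_mul (eigfun_sq_le k x) (ouVar_le hH hN (le_of_mem_dyadicBlock hk))
          (ouVar_nonneg H k) zero_le_two
    _ = _ := by
        rw [Finset.sum_const, card_dyadicBlock, nsmul_eq_mul, sub_eq_add_neg, Real.rpow_add hN,
          Real.rpow_one]
        push_cast
        ring

/-- The `j`-th dyadic block of the series of `Z(t)`, as an element of `C([0,1])`. -/
def ouBlock (β : ℕ → ℝ≥0 → Ω → ℝ) (t : ℝ≥0) (j : ℕ) (ω : Ω) : E :=
  ∑ k ∈ dyadicBlock j, ouCoeff β t k ω • eE k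

theorem aestronglyMeasurable_ouBlock (hβ : ∀ k, IsFBM H (β k) P) (t : ℝ≥0) (j : ℕ) :
    AEStronglyMeasurable (ouBlock β t j) P :=
  Finset.aestronglyMeasurable_fun_sum _ fun k _ =>
    (aemeasurable_ouCoeff hβ t k).aestronglyMeasurable.smul_const _

/-- The constant in the moment bound of the dyadic blocks. -/
def blockConst (m : ℕ) : ℝ≥0∞ :=
  2 ^ (2 * m) * (gaussMoment m * ENNReal.ofReal 48 ^ m * (2 + 10 ^ (2 * m)))

theorem blockConst_lt_top (m : ℕ) : blockConst m < ∞ := by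
  have := gaussMoment_lt_top m
  unfold blockConst
  finiteness

/-- Every grid value and every coefficient has variance at most `W`, and at most a constant times
4^j of them are summed; `hm` makes the Gaussian decay beat this count. -/
theorem lintegral_ouBlock_le (hH : 1 / 4 < H) (hH1 : H ≤ 1) (hβ : ∀ k, IsFBM H (β k) P)
    (hindep : iIndepFun (fun k ω t => β k t ω) P) (t : ℝ≥0) {m : ℕ}
    (hm : 3 ≤ (4 * H - 1) * m) (j : ℕ) :
    ∫⁻ ω, ‖ouBlock β t j ω‖ₑ ^ (2 * m) ∂P ≤ blockConst m * (1 / 2) ^ j := by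
  have hH0 : 0 < H := by linarith
  have hN : (1 : ℝ) ≤ 2 ^ j := one_le_pow₀ one_le_two
  have hN0 : (0 : ℝ) < 2 ^ j := by positivity
  set W : ℝ := 48 * ((2 : ℝ) ^ j) ^ (1 - 4 * H) with hW
  have hmeas := fun k => aemeasurable_ouCoeff hβ t k
  have hgrid : ∀ i, ∫⁻ ω, ‖∑ k ∈ dyadicBlock j, eigfun k (gridPoint j i) * ouCoeff β t k ω‖ₑ ^
      (2 * m) ∂P ≤ gaussMoment m * ENNReal.ofReal W ^ m := by
    intro i
    refine (lintegral_sum_ouCoeff_le hH0 hH1 hβ hindep t m _ _).trans ?_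
    gcongr
    exact sum_dyadicBlock_ouVar_le hH0 j _
  have hcoef : ∀ k ∈ dyadicBlock j, ∫⁻ ω, ‖ouCoeff β t k ω‖ₑ ^ (2 * m) ∂P ≤
      gaussMoment m * ENNReal.ofReal W ^ m := by
    intro k hk
    have h := lintegral_sum_ouCoeff_le hH0 hH1 hβ hindep t m {k} fun _ => 1
    simp only [Finset.sum_singleton, one_mul, one_pow] at h
    refine h.trans ?_
    gcongr
    refine (ouVar_le hH0 hN0 (le_of_mem_dyadicBlock hk)).trans ?_
    rw [hW]
    gcongr
    · norm_num
    · linarith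
  -- In powers of 2^j the claim is (1 - 4H)m + 2 ≤ -1, which is `hm`.
  have hdecay : ENNReal.ofReal W ^ m * (4 : ℝ≥0∞) ^ j ≤ ENNReal.ofReal 48 ^ m * (1 / 2) ^ j := by
    have h4 : (4 : ℝ≥0∞) = ENNReal.ofReal 4 := by simp
    have h2 : (1 / 2 : ℝ≥0∞) = ENNReal.ofReal (1 / 2) := by
      rw [ENNReal.ofReal_div_of_pos two_pos]; simp
    rw [h4, h2, ← ENNReal.ofReal_pow (by positivity), ← ENNReal.ofReal_pow (by positivity),
      ← ENNReal.ofReal_pow (by positivity), ← ENNReal.ofReal_pow (by positivity),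
      ← ENNReal.ofReal_mul (by positivity), ← ENNReal.ofReal_mul (by positivity)]
    refine ENNReal.ofReal_le_ofReal ?_
    rw [hW, mul_pow, mul_assoc]
    gcongr
    have e4 : (4 : ℝ) ^ j = ((2 : ℝ) ^ j) ^ (2 : ℝ) := by
      rw [Real.rpow_two, ← pow_mul, mul_comm j, pow_mul]; norm_num
    have e2 : (1 / 2 : ℝ) ^ j = ((2 : ℝ) ^ j) ^ (-1 : ℝ) := by
      rw [Real.rpow_neg_one, one_div, inv_pow]
    rw [e4, e2, ← Real.rpow_natCast, ← Real.rpow_mul hN0.le, ← Real.rpow_add hN0]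
    exact Real.rpow_le_rpow_of_exponent_le hN (by nlinarith)
  have hcard1 : ((4 ^ j + 1 : ℕ) : ℝ≥0∞) ≤ 2 * 4 ^ j := by
    have : 4 ^ j + 1 ≤ 2 * 4 ^ j := by have := Nat.one_le_pow j 4 (by norm_num); omega
    exact_mod_cast this
  have hcard2 : ((2 ^ j : ℕ) : ℝ≥0∞) ≤ 4 ^ j := by
    have : 2 ^ j ≤ 4 ^ j := Nat.pow_le_pow_left (by norm_num) j
    exact_mod_cast this
  calc ∫⁻ ω, ‖ouBlock β t j ω‖ₑ ^ (2 * m) ∂P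
      ≤ ∫⁻ ω, 2 ^ (2 * m) * (∑ i ∈ Finset.range (4 ^ j + 1),
          ‖∑ k ∈ dyadicBlock j, eigfun k (gridPoint j i) * ouCoeff β t k ω‖ₑ ^ (2 * m) +
          10 ^ (2 * m) * ∑ k ∈ dyadicBlock j, ‖ouCoeff β t k ω‖ₑ ^ (2 * m)) ∂P :=
        lintegral_mono fun ω => enorm_block_pow_le (fun k => ouCoeff β t k ω) j (2 * m)
    _ = 2 ^ (2 * m) * (∑ i ∈ Finset.range (4 ^ j + 1), ∫⁻ ω,
          ‖∑ k ∈ dyadicBlock j, eigfun k (gridPoint j i) * ouCoeff β t k ω‖ₑ ^ (2 * m) ∂P +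
          10 ^ (2 * m) * ∑ k ∈ dyadicBlock j, ∫⁻ ω, ‖ouCoeff β t k ω‖ₑ ^ (2 * m) ∂P) := by
        rw [lintegral_const_mul'' _ (by fun_prop), lintegral_add_left' (by fun_prop),
          lintegral_const_mul'' _ (by fun_prop), lintegral_finsetSum' _ (by fun_prop),
          lintegral_finsetSum' _ (by fun_prop)]
    _ ≤ 2 ^ (2 * m) * (∑ _i ∈ Finset.range (4 ^ j + 1), gaussMoment m * ENNReal.ofReal W ^ m +
          10 ^ (2 * m) * ∑ _k ∈ dyadicBlock j, gaussMoment m * ENNReal.ofReal W ^ m) := by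
        gcongr with i _ k hk
        · exact hgrid i
        · exact hcoef k hk
    _ = 2 ^ (2 * m) * (gaussMoment m * (ENNReal.ofReal W ^ m *
          (((4 ^ j + 1 : ℕ) : ℝ≥0∞) + 10 ^ (2 * m) * ((2 ^ j : ℕ) : ℝ≥0∞)))) := by
        rw [Finset.sum_const, Finset.sum_const, card_dyadicBlock, Finset.card_range,
          nsmul_eq_mul, nsmul_eq_mul]
        ring
    _ ≤ 2 ^ (2 * m) * (gaussMoment m * (ENNReal.ofReal W ^ m *
          (2 * 4 ^ j + 10 ^ (2 * m) * 4 ^ j))) := by gcongr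
    _ = 2 ^ (2 * m) * (gaussMoment m * ((ENNReal.ofReal W ^ m * 4 ^ j) *
          (2 + 10 ^ (2 * m)))) := by ring
    _ ≤ 2 ^ (2 * m) * (gaussMoment m * ((ENNReal.ofReal 48 ^ m * (1 / 2) ^ j) *
          (2 + 10 ^ (2 * m)))) := by gcongr
    _ = _ := by rw [blockConst]; ring

theorem ae_summable_ouCoeff_sq (hH : 1 / 4 < H) (hH1 : H ≤ 1) (hβ : ∀ k, IsFBM H (β k) P)
    (hindep : iIndepFun (fun k ω t => β k t ω) P) (t : ℝ≥0) :
    ∀ᵐ ω ∂P, Summable fun k => ouCoeff β t k ω ^ 2 := by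
  have hmeas := fun k => aemeasurable_ouCoeff hβ t k
  have hk : ∀ k, ∫⁻ ω, ‖ouCoeff β t k ω‖ₑ ^ 2 ∂P ≤
      gaussMoment 1 * ENNReal.ofReal (ouVar H k) := by
    intro k
    simpa using lintegral_sum_ouCoeff_le (by linarith) hH1 hβ hindep t 1 {k} fun _ => 1
  have h1 : ∫⁻ ω, ∑' k, ‖ouCoeff β t k ω‖ₑ ^ 2 ∂P < ∞ := by
    rw [lintegral_tsum fun k => by fun_prop]
    refine (ENNReal.tsum_le_tsum hk).trans_lt ?_
    rw [ENNReal.tsum_mul_left]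
    exact ENNReal.mul_lt_top (gaussMoment_lt_top 1) (summable_ouVar hH).tsum_ofReal_lt_top
  filter_upwards [ae_lt_top' (AEMeasurable.tsum fun k => by fun_prop) h1.ne] with ω hω
  simpa using ENNReal.summable_toReal hω.ne

/-- The continuous version of `Z(t)`. -/
def ouVersion (β : ℕ → ℝ≥0 → Ω → ℝ) (t : ℝ≥0) (ω : Ω) : E := ∑' j, ouBlock β t j ω

/-- The first J blocks form the partial sum of the L² series up to 2^J - 1, so the two limits in L²
agree. -/
theorem represents_ouVersion {Ω : Type*} {β : ℕ → ℝ≥0 → Ω → ℝ} {t : ℝ≥0} {ω : Ω} (h1 : Summable fun k => ouCoeff β t k ω ^ 2)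
    (h2 : Summable fun j => ouBlock β t j ω) : Represents (Z β t ω) (ouVersion β t ω) := by
  rw [represents_iff, Z_eq_tsum]
  have hL := (toL2.hasSum h2.hasSum).tendsto_sum_nat
  have hR := (summable_smul_e h1).hasSum.tendsto_sum_nat.comp
    ((Filter.tendsto_sub_atTop_nat 1).comp (tendsto_pow_atTop_atTop_of_one_lt one_lt_two))
  refine tendsto_nhds_unique hL (hR.congr fun J => ?_)
  simp [← sum_dyadicBlock, ouBlock, toL2_eE]

/-- The order needed for summable blocks grows without bound as H decreases to 1/4; p ≤ m lets the
moment of order 2m dominate the one requested. -/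
theorem exists_moment_order (hH : 1 / 4 < H) (p : ℕ) :
    ∃ m : ℕ, p ≤ m ∧ m ≠ 0 ∧ 3 ≤ (4 * H - 1) * m := by
  have hδ : 0 < 4 * H - 1 := by linarith
  obtain ⟨n, hn⟩ := exists_nat_gt (3 / (4 * H - 1))
  refine ⟨p + n + 1, by omega, by omega, ?_⟩
  rw [div_lt_iff₀ hδ] at hn
  push_cast
  nlinarith [(Nat.cast_nonneg p : (0 : ℝ) ≤ p)]

variable [IsProbabilityMeasure P]

theorem ae_summable_ouBlock (hH : 1 / 4 < H) (hH1 : H ≤ 1) (hβ : ∀ k, IsFBM H (β k) P)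
    (hindep : iIndepFun (fun k ω t => β k t ω) P) (t : ℝ≥0) :
    ∀ᵐ ω ∂P, Summable fun j => ouBlock β t j ω := by
  obtain ⟨m, -, hm0, hm⟩ := exists_moment_order hH 0
  exact ae_summable_of_moments (q := 2 * m) (by omega) (blockConst_lt_top m)
    (aestronglyMeasurable_ouBlock hβ t) (lintegral_ouBlock_le hH hH1 hβ hindep t hm)

theorem lintegral_ouVersion_le (hH : 1 / 4 < H) (hH1 : H ≤ 1) (hβ : ∀ k, IsFBM H (β k) P)
    (hindep : iIndepFun (fun k ω t => β k t ω) P) (t : ℝ≥0) {p m : ℕ} (hpm : p ≤ m)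
    (hm0 : m ≠ 0) (hm : 3 ≤ (4 * H - 1) * m) :
    ∫⁻ ω, ‖ouVersion β t ω‖ₑ ^ (2 * p) ∂P ≤
      1 + seriesBound (blockConst m) (2 * m) ^ (2 * m) := by
  have hpow : ∀ x : ℝ≥0∞, x ^ (2 * p) ≤ 1 + x ^ (2 * m) := by
    intro x
    rcases le_total x 1 with h | h
    · exact (pow_le_one' h _).trans le_self_add
    · exact (pow_le_pow_right₀ h (by omega)).trans le_add_self
  calc ∫⁻ ω, ‖ouVersion β t ω‖ₑ ^ (2 * p) ∂P
      ≤ ∫⁻ ω, (1 + ‖ouVersion β t ω‖ₑ ^ (2 * m)) ∂P := lintegral_mono fun ω => hpow _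
    _ = 1 + ∫⁻ ω, ‖ouVersion β t ω‖ₑ ^ (2 * m) ∂P := by
        rw [lintegral_add_left measurable_const]; simp
    _ ≤ _ := by
        gcongr
        exact lintegral_tsum_pow_le (by omega) (aestronglyMeasurable_ouBlock hβ t)
          (lintegral_ouBlock_le hH hH1 hβ hindep t hm) (ae_summable_ouBlock hH hH1 hβ hindep t)

end

end FracOU

end

theorem mainTheorem4 {Ω : Type*} [MeasurableSpace Ω] (P : Measure Ω) [IsProbabilityMeasure P]
    (H : ℝ) (hH : (1 / 4 < H ∧ H < 1 / 2) ∨ (1 / 2 < H ∧ H < 1))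
    (β : ℕ → ℝ≥0 → Ω → ℝ)
    (hβ : ∀ k, FracOU.IsFBM H (β k) P)
    (hindep : iIndepFun (fun k ω t => β k t ω) P) :
    -- the series that defines `Z(t)` converges almost surely in `L²(0,1)`
    (∀ t : ℝ≥0, ∀ᵐ ω ∂P,
      Summable (FracOU.cylTerm (fun s => FracOU.S ((t : ℝ) - s)) β t ω)) ∧
    -- its sum is almost surely in `E`, and defines an `E`-valued random variable
    ∃ ZE : ℝ≥0 → Ω → FracOU.E,
      (∀ t, AEStronglyMeasurable (ZE t) P) ∧
      (∀ t, ∀ᵐ ω ∂P, FracOU.Represents (FracOU.Z β t ω) (ZE t ω)) ∧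
      -- all moments of the `E`-norm are bounded uniformly in time
      ∀ p : ℕ, (⨆ t : ℝ≥0, ∫⁻ ω, ‖ZE t ω‖ₑ ^ (2 * p) ∂P) < ∞ := by
  have hH4 : 1 / 4 < H := by rcases hH with h | h <;> linarith
  have hH1 : H ≤ 1 := by rcases hH with h | h <;> linarith
  refine ⟨fun t => ?_, FracOU.ouVersion β, fun t => ?_, fun t => ?_, fun p => ?_⟩
  · filter_upwards [FracOU.ae_summable_ouCoeff_sq hH4 hH1 hβ hindep t] with ω hω
    exact FracOU.summable_cylTerm hω
  · exact FracOU.aestronglyMeasurable_tsum (FracOU.aestronglyMeasurable_ouBlock hβ t)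
      (FracOU.ae_summable_ouBlock hH4 hH1 hβ hindep t)
  · filter_upwards [FracOU.ae_summable_ouCoeff_sq hH4 hH1 hβ hindep t,
      FracOU.ae_summable_ouBlock hH4 hH1 hβ hindep t] with ω h1 h2
    exact FracOU.represents_ouVersion h1 h2
  · obtain ⟨m, hpm, hm0, hm⟩ := FracOU.exists_moment_order hH4 p
    refine (iSup_le fun t =>
      FracOU.lintegral_ouVersion_le hH4 hH1 hβ hindep t hpm hm0 hm).trans_lt ?_
    have := FracOU.seriesBound_lt_top (q := 2 * m) (by omega) (FracOU.blockConst_lt_top m)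
    finiteness
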